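/- For a topological space $Z$ let $\mathcal B(Z)$ be the collection of all countable covers of $Z$ by Borel subsets of $Z$. The space $Z$ satisfies $S_1(\mathcal B,\mathcal B)$ if for every sequence $(\mathcal U_n)_{n\in\omega}$ in $\mathcal B(Z)$ there are $U_n\in\mathcal U_n$ such that $\{U_n:n\in\omega\}\in\mathcal B(Z)$. A family $\mathcal N$ of subsets of $Z$ is a network if for every $z\in Z$ and every open $O\ni z$ there is $N\in\mathcal N$ with $z\in N\subseteq O$. The net weight $nw(Z)$ is the least cardinality of a network for $Z$, and the weight $w(Z)$ is the least cardinality of a base of $Z$. The space $Z$ is R-nw-selective if $nw(Z)\le\omega$ and for every sequence $(\mathcal N_n)_{n\in\omega}$ of countable networks for $Z$ there are $N_n\in\mathcal N_n$ such that $\{N_n:n\in\omega\}$ is a network for $Z$. Let $C_p(X,2)$ be the space of all continuous functions $X\to 2=\{0,1\}$ ($2$ discrete) with the topology of pointwise convergence. **Theorem.** Let $X\subseteq 2^\omega$ (with the subspace topology) be such that $X^n$ satisfies $S_1(\mathcal B,\mathcal B)$ for every $n\in\omega$, and let $Y\subseteq C_p(X,2)$ be countable, with the subspace topology. If $Y$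 is nonempty, then $Y$ is R-nw-selective. Moreover, if $X$ is infinite and $Y$ is dense in $C_p(X,2)$, then $w(Y)=|X|$. -/

import Mathlib

open Set Topology Cardinal

universe u v

/-- The selection principle `S₁(𝒜, ℬ)` for two collections `𝒜`, `ℬ` of families of subsets of `Z`:
for every sequence `(U n)` of elements of `𝒜` one can pick `V n ∈ U n` such that the family
`{V n : n ∈ ω}` belongs to `ℬ`. -/
def SelOne {Z : Type u} (𝒜 ℬ : Set (Set (Set Z))) : Prop :=
  ∀ U : ℕ → Set (Set Z), (∀ n, U n ∈ 𝒜) →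
    ∃ V : ℕ → Set Z, (∀ n, V n ∈ U n) ∧ Set.range V ∈ ℬ

/-- `𝓑(Z)`: the collection of all countable covers of `Z` by Borel subsets of `Z`. -/
def borelCovers (Z : Type u) [TopologicalSpace Z] : Set (Set (Set Z)) :=
  {U | U.Countable ∧ (∀ B ∈ U, @MeasurableSet Z (borel Z) B) ∧ ⋃₀ U = Set.univ}

/-- `C_p(X, Z)`: the continuous functions `X → Z` with the topology of pointwise convergence,
that is, the subspace topology inherited from the product `Z ^ X`. -/
abbrev Cp (X : Type u) (Z : Type v) [TopologicalSpace X] [TopologicalSpace Z] : Type (max u v) :=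
  {f : X → Z // Continuous f}

/-- A family `𝒩` of subsets of `Z` is a network if for every point `x` and every open
neighbourhood `O` of `x` there is `N ∈ 𝒩` with `x ∈ N ⊆ O`. -/
def IsNetwork {Z : Type u} [TopologicalSpace Z] (𝒩 : Set (Set Z)) : Prop :=
  ∀ (x : Z) (O : Set Z), IsOpen O → x ∈ O → ∃ N ∈ 𝒩, x ∈ N ∧ N ⊆ O

/-- The net weight `nw(Z)`: the least cardinality of a network. -/
noncomputable def netWeight (Z : Type u) [TopologicalSpace Z] : Cardinal.{u} :=
  sInf {κ | ∃ 𝒩 : Set (Set Z), IsNetwork 𝒩 ∧ #𝒩 = κ}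

/-- The weight `w(Z)`: the least cardinality of a base of the topology. -/
noncomputable def topWeight (Z : Type u) [TopologicalSpace Z] : Cardinal.{u} :=
  sInf {κ | ∃ 𝒰 : Set (Set Z), TopologicalSpace.IsTopologicalBasis 𝒰 ∧ #𝒰 = κ}

/-- `Z` is R-nw-selective: it has countable net weight, and from every sequence of countable
networks one can pick one element of each so that the picked sets form a network. -/
def RNwSelective (Z : Type u) [TopologicalSpace Z] : Prop :=
  netWeight Z ≤ ℵ₀ ∧
    ∀ 𝒩 : ℕ → Set (Set Z), (∀ n, (𝒩 n).Countable ∧ IsNetwork (𝒩 n)) →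
      ∃ N : ℕ → Set Z, (∀ n, N n ∈ 𝒩 n) ∧ IsNetwork (Set.range N)

/-!
Both halves rest on the description of neighbourhoods in `Y ⊆ C_p(X, 2)`: every neighbourhood of
`f` contains all `g ∈ Y` that agree with `f` on some finite `F ⊆ X`, and these sets are open.

*Selectivity.* Fix `f ∈ Y` and `m`, and let `𝒩` be a countable network of `Y`. For `N ∈ 𝒩` with
`f ∈ N`, the tuples `x ∈ X ^ m` at whose coordinates every `g ∈ N` agrees with `f` form a closed
set, and since `𝒩` is a network these closed sets cover `X ^ m`. Thus `S₁(𝓑, 𝓑)` for `X ^ m` picks,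
from any sequence of countable networks, sets `N n ∋ f` such that each `m`-point neighbourhood
of `f` contains some `N n` (`exists_selection_at`). There are only countably many pairs `(f, m)`, so
splitting `ℕ` into infinitely many infinite pieces serves all of them at once
(`rNwSelective_of_selOne_borelCovers`).

*Weight.* The basic open sets are indexed by `Y` and the finite subsets of `X`, so the weight is at
most `|X|`. Conversely, fix `f ∈ Y` and shrink each member of a base that contains `f` to the
neighbourhood given by a finite set; if the base has fewer than `|X|` members, then some `x ∈ X`
lies in none of these finite sets. A continuous function equal to `f` on one of them and different
from `f` at `x` always exists, and by density it may be taken in `Y`; hence no member of the base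
fits between `f` and `{g | g x = f x}`.
-/

/-! ### Neighbourhoods in the topology of pointwise convergence -/

section Neighbourhoods

variable {X : Type u} [TopologicalSpace X]

theorem Cp.isOpen_setOf_eqOn_finset (f : Cp X Bool) (F : Finset X) :
    IsOpen {g : Cp X Bool | ∀ x ∈ F, g.1 x = f.1 x} := by
  have h : {g : Cp X Bool | ∀ x ∈ F, g.1 x = f.1 x} =
      ⋂ x ∈ F, (fun g : Cp X Bool => g.1 x) ⁻¹' {f.1 x} := by
    ext g; simp
  rw [h]
  exact isOpen_biInter_finset fun x _ =>
    (isOpen_discrete _).preimage ((continuous_apply x).comp continuous_subtype_val)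

theorem Cp.exists_finset_eqOn_subset {Y : Set (Cp X Bool)} {O : Set Y} (hO : IsOpen O) {f : Y}
    (hf : f ∈ O) : ∃ F : Finset X, ∀ g : Y, (∀ x ∈ F, g.1.1 x = f.1.1 x) → g ∈ O := by
  have hind : IsInducing fun g : Y => g.1.1 := IsInducing.subtypeVal.comp IsInducing.subtypeVal
  obtain ⟨W, hW, rfl⟩ := hind.isOpen_iff.1 hO
  obtain ⟨F, u, hu, hFW⟩ := isOpen_pi_iff.1 hW _ hf
  refine ⟨F, fun g hg => hFW fun x hx => ?_⟩
  change g.1.1 x ∈ u x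
  rw [hg x hx]
  exact (hu x hx).2

end Neighbourhoods

/-! ### Selecting networks -/

section Selection

variable {X : Type u} [TopologicalSpace X]

theorem isClosed_setOf_forall_eq_comp {ι : Type v} (f : Cp X Bool) (N : Set (Cp X Bool)) :
    IsClosed {x : ι → X | ∀ g ∈ N, ∀ i, g.1 (x i) = f.1 (x i)} := by
  simp only [Set.ofPred_forall]
  exact isClosed_iInter fun g => isClosed_iInter fun _ => isClosed_iInter fun i =>
    isClosed_eq (g.2.comp (continuous_apply i)) (f.2.comp (continuous_apply i))

/-- One application of the selection principle to `X ^ m`: it handles a single point `f` and all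
neighbourhoods of `f` determined by `m` points of `X`. -/
theorem exists_selection_at {m : ℕ}
    (hX : SelOne (borelCovers (Fin m → X)) (borelCovers (Fin m → X)))
    {Y : Set (Cp X Bool)} (f : Y) (𝒩 : ℕ → Set (Set Y))
    (h𝒩 : ∀ n, (𝒩 n).Countable ∧ IsNetwork (𝒩 n)) :
    ∃ N : ℕ → Set Y, (∀ n, N n ∈ 𝒩 n) ∧ (∀ n, f ∈ N n) ∧
      ∀ x : Fin m → X, ∃ n, ∀ g ∈ N n, ∀ i, g.1.1 (x i) = f.1.1 (x i) := by
  classical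
  let agree : Set Y → Set (Fin m → X) := fun N => {x | ∀ g ∈ N, ∀ i, g.1.1 (x i) = f.1.1 (x i)}
  obtain ⟨V, hV, hVcov⟩ := hX (fun n => agree '' {N ∈ 𝒩 n | f ∈ N}) fun n => by
    refine ⟨((h𝒩 n).1.mono (sep_subset _ _)).image _, ?_, ?_⟩
    · rintro _ ⟨N, -, rfl⟩
      have hcl : IsClosed (agree N) := by
        simpa [agree] using
          isClosed_setOf_forall_eq_comp (ι := Fin m) f.1 ((fun g : Y => g.1) '' N)
      let _ : MeasurableSpace (Fin m → X) := borel _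
      have : BorelSpace (Fin m → X) := ⟨rfl⟩
      exact hcl.measurableSet
    · refine eq_univ_of_forall fun x => ?_
      obtain ⟨N, hN, hfN, hNO⟩ := (h𝒩 n).2 f
        {g : Y | ∀ y ∈ Finset.univ.image x, g.1.1 y = f.1.1 y}
        ((Cp.isOpen_setOf_eqOn_finset f.1 _).preimage continuous_subtype_val)
        (fun _ _ => rfl)
      exact ⟨agree N, ⟨N, ⟨hN, hfN⟩, rfl⟩, fun g hg i =>
        hNO hg (x i) (Finset.mem_image_of_mem x (Finset.mem_univ i))⟩
  choose N hN hNV using hV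
  refine ⟨N, fun n => (hN n).1, fun n => (hN n).2, fun x => ?_⟩
  obtain ⟨_, ⟨n, rfl⟩, hx⟩ := hVcov.2.2.symm ▸ mem_univ x
  rw [← hNV n] at hx
  exact ⟨n, hx⟩

theorem netWeight_le_aleph0_of_countable (Z : Type u) [TopologicalSpace Z] [Countable Z] :
    netWeight Z ≤ ℵ₀ := by
  have hnet : IsNetwork (range fun z : Z => ({z} : Set Z)) :=
    fun z O _ hz => ⟨{z}, ⟨z, rfl⟩, rfl, singleton_subset_iff.2 hz⟩
  have hle : netWeight Z ≤ #(range fun z : Z => ({z} : Set Z)) := csInf_le' ⟨_, hnet, rfl⟩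
  exact hle.trans (countable_range _).le_aleph0

theorem rNwSelective_of_selOne_borelCovers
    (hX : ∀ n : ℕ, SelOne (borelCovers (Fin n → X)) (borelCovers (Fin n → X)))
    {Y : Set (Cp X Bool)} (hY : Y.Countable) (hne : Y.Nonempty) : RNwSelective Y := by
  have := hY.to_subtype
  have := hne.to_subtype
  refine ⟨netWeight_le_aleph0_of_countable Y, fun 𝒩 h𝒩 => ?_⟩
  obtain ⟨e, he⟩ := exists_surjective_nat (Y × ℕ)
  -- The indices `Nat.pair k j`, `j ∈ ℕ`, are reserved for the `k`-th pair (point, tuple length).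
  choose N hN hfN hcov using fun k =>
    exists_selection_at (hX (e k).2) (e k).1 (fun j => 𝒩 (Nat.pair k j)) fun j => h𝒩 _
  refine ⟨fun n => N n.unpair.1 n.unpair.2, fun n => ?_, fun f O hO hfO => ?_⟩
  · simpa using hN n.unpair.1 n.unpair.2
  · obtain ⟨F, hF⟩ := Cp.exists_finset_eqOn_subset hO hfO
    obtain ⟨k, hk⟩ := he (f, F.card)
    have hfk : (e k).1 = f := by rw [hk]
    have hmk : F.card = (e k).2 := by rw [hk]
    obtain ⟨j, hj⟩ := hcov k fun i => (F.equivFinOfCardEq hmk).symm i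
    refine ⟨N k j, ⟨Nat.pair k j, by simp⟩, hfk ▸ hfN k j, fun g hg => hF g fun x hx => ?_⟩
    simpa [hfk] using hj g hg (F.equivFinOfCardEq hmk ⟨x, hx⟩)

end Selection

/-! ### The weight of a dense subspace -/

section Weight

theorem Cp.topWeight_le {X : Type u} [TopologicalSpace X] [Infinite X] {Y : Set (Cp X Bool)}
    (hY : Y.Countable) : topWeight Y ≤ #X := by
  have := hY.to_subtype
  let nbhd : Y × Finset X → Set Y := fun p => {g | ∀ x ∈ p.2, g.1.1 x = p.1.1.1 x}
  have hbasis : TopologicalSpace.IsTopologicalBasis (range nbhd) := by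
    refine TopologicalSpace.isTopologicalBasis_of_isOpen_of_nhds ?_ fun f O hf hO => ?_
    · rintro _ ⟨p, rfl⟩
      exact (Cp.isOpen_setOf_eqOn_finset p.1.1 p.2).preimage continuous_subtype_val
    · obtain ⟨F, hF⟩ := Cp.exists_finset_eqOn_subset hO hf
      exact ⟨nbhd (f, F), ⟨_, rfl⟩, fun _ _ => rfl, hF⟩
  calc topWeight Y ≤ #(range nbhd) := csInf_le' ⟨_, hbasis, rfl⟩
    _ ≤ #(Y × Finset X) := mk_range_le
    _ = #Y * #X := by rw [mk_prod, lift_id, lift_id, mk_finset_of_infinite]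
    _ ≤ #X := mul_le_of_le (aleph0_le_mk X) ((mk_le_aleph0 (α := Y)).trans (aleph0_le_mk X)) le_rfl

/-- Points of the Cantor space are separated from finite sets by clopen sets, so a continuous
two-valued function can be flipped at a point without changing it on a given finite set. -/
theorem Cp.exists_eqOn_finset_ne {X : Set (ℕ → Bool)} (f : Cp X Bool) {F : Finset X} {x : X}
    (hx : x ∉ F) : ∃ g : Cp X Bool, (∀ y ∈ F, g.1 y = f.1 y) ∧ g.1 x ≠ f.1 x := by
  have hsep : ∀ y : X, ∃ i, y ∈ F → y.1 i ≠ x.1 i := fun y => by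
    by_cases hy : y ∈ F
    · obtain ⟨i, hi⟩ := Function.ne_iff.1 fun h : y.1 = x.1 => hx (Subtype.ext h ▸ hy)
      exact ⟨i, fun _ => hi⟩
    · exact ⟨0, fun h => absurd h hy⟩
  choose i hi using hsep
  let C : Set X := ⋂ y ∈ F, (fun z : X => z.1 (i y)) ⁻¹' {x.1 (i y)}
  have hC : IsClopen C := isClopen_biInter_finset fun y _ =>
    (isClopen_discrete _).preimage ((continuous_apply (i y)).comp continuous_subtype_val)
  have hxC : x ∈ C := by simp [C]
  have hFC : ∀ y ∈ F, y ∉ C := fun y hy hyC => hi y hy (by simpa using mem_iInter₂.1 hyC y hy)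
  refine ⟨⟨fun z => xor (f.1 z) (C.boolIndicator z), ?_⟩, fun y hy => ?_, ?_⟩
  · exact (continuous_of_discreteTopology (f := fun p : Bool × Bool => xor p.1 p.2)).comp
      (f.2.prodMk ((continuous_boolIndicator_iff_isClopen C).2 hC))
  · simp [(notMem_iff_boolIndicator C y).1 (hFC y hy)]
  · simp [(mem_iff_boolIndicator C x).1 hxC]

/-- Fewer than `|X|` finite sets do not cover an infinite `X`. -/
theorem exists_forall_notMem_finset {ι X : Type u} [Infinite X] (F : ι → Finset X)
    (h : #ι < #X) : ∃ x, ∀ j, x ∉ F j := by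
  by_contra! hcov
  have hU : (⋃ j, (F j : Set X)) = Set.univ := eq_univ_of_forall fun x => mem_iUnion.2 (hcov x)
  rcases finite_or_infinite ι with hι | hι
  · exact infinite_univ (hU ▸ finite_iUnion fun j => (F j).finite_toSet)
  · refine h.not_ge ?_
    calc #X = #(⋃ j, (F j : Set X)) := by rw [hU, mk_univ]
      _ ≤ #ι * ⨆ j, #(F j : Set X) := mk_iUnion_le _
      _ ≤ #ι * ℵ₀ := by
        gcongr
        exact ciSup_le' fun j => ((F j).finite_toSet.countable).le_aleph0
      _ = #ι := mul_aleph0_eq (aleph0_le_mk ι)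

theorem Cp.le_topWeight_of_dense {X : Set (ℕ → Bool)} (hX : X.Infinite) {Y : Set (Cp X Bool)}
    (hY : Dense Y) : #X ≤ topWeight Y := by
  classical
  have := hX.to_subtype
  refine le_csInf ⟨_, _, TopologicalSpace.isTopologicalBasis_opens, rfl⟩ ?_
  rintro _ ⟨𝒰, h𝒰, rfl⟩
  by_contra! hlt
  obtain ⟨f, hf⟩ : Y.Nonempty :=
    have : Nonempty (Cp X Bool) := ⟨⟨fun _ => false, continuous_const⟩⟩
    hY.nonempty
  have hshrink : ∀ U : 𝒰, ∃ F : Finset X, (⟨f, hf⟩ : Y) ∈ U.1 →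
      ∀ g : Y, (∀ x ∈ F, g.1.1 x = f.1 x) → g ∈ U.1 := fun U => by
    by_cases hfU : (⟨f, hf⟩ : Y) ∈ U.1
    · obtain ⟨F, hF⟩ := Cp.exists_finset_eqOn_subset (h𝒰.isOpen U.2) hfU
      exact ⟨F, fun _ => hF⟩
    · exact ⟨∅, fun h => absurd h hfU⟩
  choose F hF using hshrink
  obtain ⟨x, hx⟩ := exists_forall_notMem_finset F hlt
  obtain ⟨U, hU, hfU, hUx⟩ := h𝒰.exists_subset_of_mem_open
    (a := (⟨f, hf⟩ : Y)) (u := {g : Y | ∀ y ∈ ({x} : Finset X), g.1.1 y = f.1 y})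
    (fun _ _ => rfl) ((Cp.isOpen_setOf_eqOn_finset f {x}).preimage continuous_subtype_val)
  obtain ⟨g, hgF, hgx⟩ := Cp.exists_eqOn_finset_ne f (hx ⟨U, hU⟩)
  obtain ⟨g', hg', hg'Y⟩ := hY.inter_open_nonempty _
    (Cp.isOpen_setOf_eqOn_finset g (insert x (F ⟨U, hU⟩))) ⟨g, fun _ _ => rfl⟩
  refine hgx ((hg' x (Finset.mem_insert_self _ _)).symm.trans ?_)
  exact hUx (hF ⟨U, hU⟩ hfU ⟨g', hg'Y⟩ fun y hy =>
    (hg' y (Finset.mem_insert_of_mem hy)).trans (hgF y hy)) x (Finset.mem_singleton_self x)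

end Weight

theorem mainTheorem4 (X : Set (ℕ → Bool))
    (hX : ∀ n : ℕ, SelOne (borelCovers (Fin n → X)) (borelCovers (Fin n → X)))
    (Y : Set (Cp X Bool)) (hY : Y.Countable) :
    (Y.Nonempty → RNwSelective Y) ∧
      (X.Infinite → Dense Y → topWeight Y = #X) := by
  refine ⟨rNwSelective_of_selOne_borelCovers hX hY, fun hinf hdense => ?_⟩
  have := hinf.to_subtype
  exact (Cp.topWeight_le hY).antisymm (Cp.le_topWeight_of_dense hinf hdense)
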